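/- Let $\mathcal H$ be a complex separable infinite-dimensional Hilbert space, let $\mathcal B(\mathcal H)$ be the algebra of bounded linear operators on $\mathcal H$, and let $$\ell_\infty(\mathbb N,\mathcal B(\mathcal H))=\{(A_n)_n : A_n\in\mathcal B(\mathcal H)\ (n\in\mathbb N),\ \sup_n\|A_n\|<\infty\}$$ with coordinatewise operations. A linear map $\phi$ between complex algebras is called a Jordan homomorphism if $\phi(A)^2=\phi(A^2)$ for every $A$ (no continuity is assumed). A sequence is called cofinite if all but finitely many of its coordinates are zero. (i) There is no nonzero Jordan homomorphism $\Phi:\ell_\infty(\mathbb N,\mathcal B(\mathcal H))\to\mathcal B(\mathcal H)$ that vanishes on the set of all cofinite sequences. (ii) More generally, there is no nonzero Jordan homomorphism $\Phi:\ell_\infty(\mathbb N,\mathcal B(\mathcal H))\to\mathcal B(\mathcal H)$ that vanishes on all cofinite sequences whose coordinates have finite rank. (iii) In contrast, for the scalar algebra $\ell_\infty$ of bounded complex sequences: the set $\beta\mathbb N\setminus\mathbb N$ is nonempty, every $f\in\ell_\infty$ has a unique continuous extension $\tilde f:\beta\mathbb N\to\mathbb C$ to the Stone–Čech compactification of $\mathbb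 N$, and for every $p\in\beta\mathbb N\setminus\mathbb N$ the map $f\mapsto\tilde f(p)$ is a unital algebra homomorphism $\ell_\infty\to\mathbb C$ (in particular a nonzero character) that vanishes on all cofinite sequences in $\ell_\infty$. -/

import Mathlib

open scoped ENNReal

/-- A linear map `φ` between complex (associative, not necessarily unital) algebras is a Jordan
homomorphism if it preserves squares. -/
def IsJordanHom {R R' : Type*}
    [NonUnitalRing R] [Module ℂ R] [IsScalarTower ℂ R R] [SMulCommClass ℂ R R]
    [NonUnitalRing R'] [Module ℂ R'] [IsScalarTower ℂ R' R'] [SMulCommClass ℂ R' R']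
    (φ : R →ₗ[ℂ] R') : Prop :=
  ∀ a : R, φ a * φ a = φ (a * a)

/-- A cofinite sequence: one with only finitely many nonzero coordinates. -/
def IsCofiniteSeq {E : Type*} [Zero E] (f : ℕ → E) : Prop :=
  {n : ℕ | f n ≠ 0}.Finite

/-- A bounded operator has finite rank if its range is finite-dimensional. -/
def IsFiniteRankOp {H : Type*} [NormedAddCommGroup H] [InnerProductSpace ℂ H]
    (T : H →L[ℂ] H) : Prop :=
  FiniteDimensional ℂ (LinearMap.range (T : H →ₗ[ℂ] H))

/-! Distinct binary sequences share only finitely many prefixes, so the prefix sets form an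
uncountable almost disjoint family. At coordinate `n`, each sequence `i` yields an isometry of a
Hilbert basis onto the vectors coded by its prefixes of length at least `n`. The range projections
`v i * u i` are equivalent to the identity, and for `i ≠ j` their products are cofinite with
finite-rank coordinates, hence killed by `Φ`. If `Φ ≠ 0`, the `Φ (v i * u i)` are nonzero
idempotents (`IsJordanHom.eq_zero_of_map_eq_zero`) with pairwise zero products: uncountably many,
which separability forbids (`countable_of_orthogonal_idempotents`). The scalar case is evaluation at
a point of the Stone–Čech remainder. -/

section Jordan

/-! ### Kernels of Jordan homomorphisms -/

variable {R R' : Type*}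
  [NonUnitalRing R] [Module ℂ R] [IsScalarTower ℂ R R] [SMulCommClass ℂ R R]
  [NonUnitalRing R'] [Module ℂ R'] [IsScalarTower ℂ R' R'] [SMulCommClass ℂ R' R']
  {φ : R →ₗ[ℂ] R'}

theorem IsJordanHom.map_mul_add_mul (h : IsJordanHom φ) (a b : R) :
    φ (a * b + b * a) = φ a * φ b + φ b * φ a := by
  have h1 := h (a + b)
  have e : (a + b) * (a + b) = a * a + (a * b + b * a) + b * b := by noncomm_ring
  rw [e, map_add, map_add, map_add, ← h a, ← h b] at h1
  have e2 : (φ a + φ b) * (φ a + φ b)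
      = φ a * φ a + (φ a * φ b + φ b * φ a) + φ b * φ b := by noncomm_ring
  rw [e2] at h1
  exact (add_left_cancel (add_right_cancel h1)).symm

theorem IsJordanHom.map_jordan_eq_zero (h : IsJordanHom φ) {b : R} (hb : φ b = 0) (a : R) :
    φ (a * b + b * a) = 0 := by
  simp [h.map_mul_add_mul, hb]

theorem eq_zero_of_add_self_eq_zero_of_complex {M : Type*} [AddCommGroup M] [Module ℂ M] {x : M}
    (h : x + x = 0) : x = 0 := by
  rw [← two_smul ℂ x] at h
  exact (smul_eq_zero.mp h).resolve_left two_ne_zero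

/-- The kernel of a Jordan homomorphism absorbs the Jordan triple product. -/
theorem IsJordanHom.map_triple_eq_zero (h : IsJordanHom φ) {b : R} (hb : φ b = 0) (a c : R) :
    φ (a * b * c + c * b * a) = 0 := by
  apply eq_zero_of_add_self_eq_zero_of_complex
  rw [← map_add]
  have e : a * b * c + c * b * a + (a * b * c + c * b * a)
      = (a * (c * b + b * c) + (c * b + b * c) * a) + (c * (a * b + b * a) + (a * b + b * a) * c)
        - ((a * c + c * a) * b + b * (a * c + c * a)) := by noncomm_ring
  rw [e, map_sub, map_add, h.map_jordan_eq_zero (h.map_jordan_eq_zero hb c) a,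
    h.map_jordan_eq_zero (h.map_jordan_eq_zero hb a) c, h.map_jordan_eq_zero hb]
  simp

theorem IsJordanHom.map_conj_eq_zero (h : IsJordanHom φ) {b : R} (hb : φ b = 0) (a : R) :
    φ (a * b * a) = 0 := by
  apply eq_zero_of_add_self_eq_zero_of_complex
  rw [← map_add, h.map_triple_eq_zero hb]

/-- A Jordan homomorphism that kills an idempotent equivalent to the identity is zero. -/
theorem IsJordanHom.eq_zero_of_map_eq_zero (h : IsJordanHom φ) {e u v : R}
    (el : ∀ a, e * a = a) (er : ∀ a, a * e = a) (huv : u * v = e) (hp : φ (v * u) = 0) :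
    φ = 0 := by
  have uva : ∀ a, u * (v * a) = a := fun a => by rw [← mul_assoc, huv, el]
  -- With `p = v * u`, the triple product is `e + v * p * u`. Since `(e - p) * v = 0`, compressing
  -- by `e - p` leaves `e - p`, so `p` and `e - p` both lie in the kernel, and hence so does `e`.
  have h1 := h.map_conj_eq_zero (h.map_triple_eq_zero hp u v) (e - v * u)
  have e1 : (e - v * u) * (u * (v * u) * v + v * (v * u) * u) * (e - v * u) = e - v * u := by
    simp only [sub_mul, mul_sub, add_mul, mul_add, mul_assoc, el, er, uva, huv]
    abel
  rw [e1, map_sub, hp, sub_zero] at h1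
  ext a
  apply eq_zero_of_add_self_eq_zero_of_complex
  have := h.map_jordan_eq_zero h1 a
  rwa [el, er, map_add] at this

end Jordan

/-! ### Orthogonal families and separability -/

/-- Multiplying `e * f = -(f * e)` by `e` on either side shows that both `e * f` and `f * e` equal
`-(e * f * e)`. This is needed because a Jordan homomorphism only controls `a * b + b * a`. -/
theorem mul_eq_zero_of_idempotent_of_anticommute {R : Type*} [NonUnitalRing R] [Module ℂ R]
    {e f : R} (he : e * e = e) (h : e * f + f * e = 0) : e * f = 0 := by
  have h1 : e * f = - (f * e) := eq_neg_of_add_eq_zero_left h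
  have h2 : e * f = - (e * f * e) := by
    conv_lhs => rw [← he, mul_assoc, h1, mul_neg, ← mul_assoc]
  have h3 : f * e = - (e * f * e) := by
    rw [h1, neg_mul, neg_neg, mul_assoc, he]
  have h4 : e * f = f * e := by rw [h2, ← h3]
  apply eq_zero_of_add_self_eq_zero_of_complex
  nth_rw 2 [h4]
  exact h

/-- On a separable space, a family of nonzero bounded idempotents with pairwise zero products
is countable. -/
theorem countable_of_orthogonal_idempotents {𝕜 E ι : Type*} [RCLike 𝕜] [NormedAddCommGroup E]
    [NormedSpace 𝕜 E] [TopologicalSpace.SeparableSpace E] (P : ι → E →L[𝕜] E)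
    (hP : ∀ i, P i * P i = P i) (h0 : ∀ i, P i ≠ 0) (ho : ∀ i j, i ≠ j → P i * P j = 0) :
    Countable ι := by
  have hx : ∀ i, ∃ x : E, ‖x‖ = 1 ∧ P i x = x := by
    intro i
    obtain ⟨y, hy⟩ : ∃ y, P i y ≠ 0 := by
      by_contra! hc
      exact h0 i (ContinuousLinearMap.ext hc)
    refine ⟨((‖P i y‖⁻¹ : ℝ) : 𝕜) • P i y, ?_, ?_⟩
    · have : ‖P i y‖ ≠ 0 := norm_ne_zero_iff.mpr hy
      simp [norm_smul, this]
    · have := DFunLike.congr_fun (hP i) y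
      simp only [mul_apply_eq_comp] at this
      rw [map_smul, this]
  choose x hx1 hx2 using hx
  have hpos : ∀ i, 0 < ‖P i‖ := fun i => norm_pos_iff.mpr (h0 i)
  -- The norms `‖P i‖` may be unbounded, so the ball radii are scaled by `‖P i‖⁻¹`. The projection
  -- of smaller norm fixes `x i` and kills `x j`; a common point `d` would then force `‖x i‖ < 1`.
  have key : ∀ i j, i ≠ j → ‖P i‖ ≤ ‖P j‖ → ∀ d, ‖P i‖ * ‖d - x i‖ < 1 / 2 →
      ‖P j‖ * ‖d - x j‖ < 1 / 2 → False := by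
    intro i j hij hle d hdi hdj
    have hz : P i (x j) = 0 := by
      have := DFunLike.congr_fun (ho i j hij) (x j)
      simpa [hx2] using this
    have h1 : ‖P i (d - x i)‖ ≤ ‖P i‖ * ‖d - x i‖ := (P i).le_opNorm _
    have h2 : ‖P i (d - x j)‖ ≤ ‖P i‖ * ‖d - x j‖ := (P i).le_opNorm _
    have h3 : ‖P i‖ * ‖d - x j‖ ≤ ‖P j‖ * ‖d - x j‖ := by gcongr
    have h4 : x i = P i (d - x j) - P i (d - x i) := by simp [hz, hx2]
    have h5 := norm_sub_le (P i (d - x j)) (P i (d - x i))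
    rw [← h4, hx1] at h5
    linarith
  have mem : ∀ i d, d ∈ Metric.ball (x i) (1 / 2 / ‖P i‖) → ‖P i‖ * ‖d - x i‖ < 1 / 2 := by
    intro i d hd
    rw [mem_ball_iff_norm, lt_div_iff₀ (hpos i)] at hd
    rwa [mul_comm]
  refine Pairwise.countable_of_isOpen_disjoint
    (s := fun i => Metric.ball (x i) (1 / 2 / ‖P i‖)) ?_ (fun i => Metric.isOpen_ball)
    (fun i => Metric.nonempty_ball.mpr (by have := hpos i; positivity))
  intro i j hij
  refine Set.disjoint_left.mpr fun d hdi hdj => ?_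
  rcases le_total ‖P i‖ ‖P j‖ with hle | hle
  · exact key i j hij hle d (mem i d hdi) (mem j d hdj)
  · exact key j i hij.symm hle d (mem j d hdj) (mem i d hdi)

theorem Orthonormal.countable_of_separable {𝕜 E ι : Type*} [RCLike 𝕜] [NormedAddCommGroup E]
    [InnerProductSpace 𝕜 E] [TopologicalSpace.SeparableSpace E] {v : ι → E}
    (hv : Orthonormal 𝕜 v) : Countable ι := by
  refine Pairwise.countable_of_isOpen_disjoint
    (s := fun i => Metric.ball (v i) (1 / 2)) ?_ (fun i => Metric.isOpen_ball)
    (fun i => Metric.nonempty_ball.mpr (by norm_num))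
  intro i j hij
  refine Metric.ball_disjoint_ball ?_
  have h : ‖v i - v j‖ ^ 2 = 2 := by
    rw [@norm_sub_sq 𝕜, hv.2 hij, hv.1 i, hv.1 j]
    norm_num
  rw [dist_eq_norm]
  nlinarith [norm_nonneg (v i - v j)]

/-! ### Isometries permuting a Hilbert basis -/

section Shift

variable {ι H : Type*} [NormedAddCommGroup H] [InnerProductSpace ℂ H]

theorem HilbertBasis.apply_eq_sum_of_apply_eq_zero (b : HilbertBasis ι ℂ H) (T : H →L[ℂ] H)
    (S : Finset ι) (hT : ∀ k ∉ S, T (b k) = 0) (x : H) :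
    T x = ∑ k ∈ S, b.repr x k • T (b k) := by
  have h := (b.hasSum_repr x).mapL T
  simp only [map_smul] at h
  refine h.unique (hasSum_sum_of_ne_finset_zero fun k hk => ?_)
  simp [hT k hk]

theorem HilbertBasis.isFiniteRankOp_of_apply_eq_zero (b : HilbertBasis ι ℂ H) (T : H →L[ℂ] H)
    (S : Finset ι) (hT : ∀ k ∉ S, T (b k) = 0) : IsFiniteRankOp T := by
  classical
  have hle : LinearMap.range (T : H →ₗ[ℂ] H)
      ≤ Submodule.span ℂ ((S.image fun k => T (b k) : Finset H) : Set H) := by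
    rintro _ ⟨x, rfl⟩
    rw [ContinuousLinearMap.coe_coe, b.apply_eq_sum_of_apply_eq_zero T S hT x]
    refine Submodule.sum_mem _ fun k hk => Submodule.smul_mem _ _ (Submodule.subset_span ?_)
    exact Finset.mem_coe.mpr (Finset.mem_image_of_mem _ hk)
  exact Submodule.finiteDimensional_of_le hle

variable [CompleteSpace H]

/-- The isometry that permutes the vectors of a Hilbert basis along an injective map. -/
noncomputable def HilbertBasis.shift (b : HilbertBasis ι ℂ H) (g : ι ↪ ι) : H →L[ℂ] H :=
  (((b.orthonormal.comp g g.injective).orthogonalFamily.linearIsometry).comp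
    b.repr.toLinearIsometry).toContinuousLinearMap

theorem HilbertBasis.shift_apply (b : HilbertBasis ι ℂ H) (g : ι ↪ ι) (k : ι) :
    b.shift g (b k) = b (g k) := by
  classical
  simp only [HilbertBasis.shift, LinearIsometry.coe_toContinuousLinearMap,
    LinearIsometry.coe_comp, Function.comp_apply, LinearIsometryEquiv.coe_toLinearIsometry,
    HilbertBasis.repr_self]
  rw [OrthogonalFamily.linearIsometry_apply_single]
  simp

theorem HilbertBasis.norm_shift_le (b : HilbertBasis ι ℂ H) (g : ι ↪ ι) : ‖b.shift g‖ ≤ 1 :=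
  LinearIsometry.norm_toContinuousLinearMap_le _

theorem HilbertBasis.adjoint_shift_mul_shift (b : HilbertBasis ι ℂ H) (g : ι ↪ ι) :
    ContinuousLinearMap.adjoint (b.shift g) * b.shift g = 1 := by
  exact (ContinuousLinearMap.norm_map_iff_adjoint_comp_self _).mp
    fun x => LinearIsometry.norm_map _ x

theorem HilbertBasis.adjoint_shift_mul_shift_apply (b : HilbertBasis ι ℂ H) (g h : ι ↪ ι) (k : ι)
    (hk : h k ∉ Set.range g) :
    (ContinuousLinearMap.adjoint (b.shift g) * b.shift h) (b k) = 0 := by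
  apply b.repr.injective
  ext l
  have hne : g l ≠ h k := fun hc => hk ⟨l, hc⟩
  rw [HilbertBasis.repr_apply_apply, mul_apply_eq_comp, b.shift_apply,
    ContinuousLinearMap.adjoint_inner_right, b.shift_apply, b.orthonormal.2 hne]
  simp

end Shift

theorem IsFiniteRankOp.mul_mul {H : Type*} [NormedAddCommGroup H] [InnerProductSpace ℂ H]
    {T : H →L[ℂ] H} (hT : IsFiniteRankOp T) (A B : H →L[ℂ] H) : IsFiniteRankOp (A * T * B) := by
  unfold IsFiniteRankOp at *
  have hle : LinearMap.range ((A * T * B : H →L[ℂ] H) : H →ₗ[ℂ] H)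
      ≤ (LinearMap.range (T : H →ₗ[ℂ] H)).map (A : H →ₗ[ℂ] H) := by
    rintro _ ⟨x, rfl⟩
    exact ⟨T (B x), ⟨B x, rfl⟩, rfl⟩
  exact Submodule.finiteDimensional_of_le hle

/-! ### Almost disjoint sets of prefixes -/

/-- The code of the prefix of length `n + k` of a binary sequence, as a function of `k`. -/
def prefixCode (i : ℕ → Bool) (n : ℕ) : ℕ ↪ ℕ where
  -- The offset `n` discards short prefixes, so those common to two distinct sequences disappear
  -- once `n` is large.
  toFun k := Encodable.encode ((List.range (n + k)).map i)
  inj' k l h := by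
    have := congrArg List.length (Encodable.encode_injective h)
    simpa using this

theorem prefixCode_eq {i j : ℕ → Bool} {n k l : ℕ} (h : prefixCode i n k = prefixCode j n l) :
    ∀ d < n + k, i d = j d := by
  have h' : (List.range (n + k)).map i = (List.range (n + l)).map j :=
    Encodable.encode_injective h
  have hl : k = l := by simpa using congrArg List.length h'
  subst hl
  intro d hd
  exact List.map_inj_left.mp h' d (List.mem_range.mpr hd)

/-- Different binary sequences have only finitely many common prefixes. -/
theorem exists_prefixCode_bound {i j : ℕ → Bool} (hij : i ≠ j) :
    ∃ d, ∀ n k, prefixCode j n k ∈ Set.range (prefixCode i n) → n + k ≤ d := by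
  obtain ⟨d, hd⟩ := Function.ne_iff.mp hij
  refine ⟨d, fun n k ⟨l, hl⟩ => ?_⟩
  by_contra! hc
  exact hd (prefixCode_eq hl.symm d hc).symm

theorem memℓp_infty_of_norm_le {ι : Type*} {E : ι → Type*} [∀ i, NormedAddCommGroup (E i)]
    {f : ∀ i, E i} (C : ℝ) (h : ∀ i, ‖f i‖ ≤ C) : Memℓp f ∞ :=
  memℓp_infty ⟨C, by rintro _ ⟨i, rfl⟩; exact h i⟩

theorem exists_hilbertBasis_nat {H : Type*} [NormedAddCommGroup H] [InnerProductSpace ℂ H]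
    [CompleteSpace H] [TopologicalSpace.SeparableSpace H] (hH : ¬ FiniteDimensional ℂ H) :
    Nonempty (HilbertBasis ℕ ℂ H) := by
  obtain ⟨w, b, -⟩ := exists_hilbertBasis ℂ H
  have : Countable w := b.orthonormal.countable_of_separable
  have : Infinite w := by
    by_contra hfin
    rw [not_infinite_iff_finite] at hfin
    have := Fintype.ofFinite w
    exact hH b.toOrthonormalBasis.toBasis.finiteDimensional_of_finite
  obtain ⟨e⟩ := nonempty_equiv_of_countable (α := ℕ) (β := w)
  refine ⟨HilbertBasis.mk (b.orthonormal.comp e e.injective) ?_⟩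
  rw [Set.range_comp, e.surjective.range_eq, Set.image_univ, b.dense_span]

/-! ### The operator-valued case -/

theorem IsJordanHom.eq_zero_of_finiteRank_cofinite {H : Type*} [NormedAddCommGroup H]
    [InnerProductSpace ℂ H] [CompleteSpace H] [TopologicalSpace.SeparableSpace H]
    (hH : ¬ FiniteDimensional ℂ H)
    {Φ : lp (fun _ : ℕ => H →L[ℂ] H) ∞ →ₗ[ℂ] (H →L[ℂ] H)} (hΦ : IsJordanHom Φ)
    (hv : ∀ A : lp (fun _ : ℕ => H →L[ℂ] H) ∞, IsCofiniteSeq (fun n => A n) →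
      (∀ n, IsFiniteRankOp (A n)) → Φ A = 0) : Φ = 0 := by
  by_contra hne
  obtain ⟨b⟩ := exists_hilbertBasis_nat hH
  let v (i : ℕ → Bool) : lp (fun _ : ℕ => H →L[ℂ] H) ∞ :=
    ⟨fun n => b.shift (prefixCode i n), memℓp_infty_of_norm_le 1 fun n => b.norm_shift_le _⟩
  let u (i : ℕ → Bool) : lp (fun _ : ℕ => H →L[ℂ] H) ∞ :=
    ⟨fun n => ContinuousLinearMap.adjoint (b.shift (prefixCode i n)),
      memℓp_infty_of_norm_le 1 fun n => by
        rw [LinearIsometryEquiv.norm_map]; exact b.norm_shift_le _⟩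
  let e : lp (fun _ : ℕ => H →L[ℂ] H) ∞ :=
    ⟨fun _ => 1, memℓp_infty_of_norm_le ‖(1 : H →L[ℂ] H)‖ fun _ => le_rfl⟩
  have el : ∀ a, e * a = a := fun a => lp.ext (funext fun n => one_mul (a n))
  have er : ∀ a, a * e = a := fun a => lp.ext (funext fun n => mul_one (a n))
  have huv : ∀ i, u i * v i = e := fun i =>
    lp.ext (funext fun n => b.adjoint_shift_mul_shift (prefixCode i n))
  have hidem : ∀ i, v i * u i * (v i * u i) = v i * u i := fun i => by
    rw [mul_assoc, ← mul_assoc (u i), huv, el]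
  have hfin : ∀ i j, i ≠ j →
      ∃ d, ∀ n, ∀ k ∉ (Finset.range (d + 1 - n)),
        (ContinuousLinearMap.adjoint (b.shift (prefixCode i n)) * b.shift (prefixCode j n)) (b k)
          = 0 := by
    intro i j hij
    obtain ⟨d, hd⟩ := exists_prefixCode_bound hij
    refine ⟨d, fun n k hk => b.adjoint_shift_mul_shift_apply _ _ _ fun hc => hk ?_⟩
    have := hd n k hc
    exact Finset.mem_range.mpr (by omega)
  have happ : ∀ i j n, (v i * u i * (v j * u j)) n =
      b.shift (prefixCode i n) *
        (ContinuousLinearMap.adjoint (b.shift (prefixCode i n)) * b.shift (prefixCode j n)) *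
        ContinuousLinearMap.adjoint (b.shift (prefixCode j n)) := fun i j n => by
    simp only [lp.infty_coeFn_mul, Pi.mul_apply, mul_assoc, v, u]
  have hkill : ∀ i j, i ≠ j → Φ (v i * u i * (v j * u j)) = 0 := by
    intro i j hij
    obtain ⟨d, hd⟩ := hfin i j hij
    -- For `n > d` the truncated difference `d + 1 - n` is `0`, so the coordinate vanishes; for `n ≤
    -- d` it has finite rank.
    refine hv _ ((Set.finite_le_nat d).subset fun n hn => ?_) fun n => ?_
    · by_contra hc
      refine hn ((happ i j n).trans ?_)
      have hz : ContinuousLinearMap.adjoint (b.shift (prefixCode i n)) *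
          b.shift (prefixCode j n) = 0 := by
        ext x
        rw [b.apply_eq_sum_of_apply_eq_zero _ _ (hd n) x]
        have : d + 1 - n = 0 := by simp only [Set.mem_ofPred_eq] at hc; omega
        simp [this]
      rw [hz, mul_zero, zero_mul]
    · rw [happ]
      exact (b.isFiniteRankOp_of_apply_eq_zero _ _ (hd n)).mul_mul _ _
  have hcount : Countable (ℕ → Bool) := by
    have hP : ∀ i, Φ (v i * u i) * Φ (v i * u i) = Φ (v i * u i) := fun i => by
      rw [hΦ, hidem]
    refine countable_of_orthogonal_idempotents (fun i => Φ (v i * u i)) hP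
      (fun i h0 => hne (hΦ.eq_zero_of_map_eq_zero el er (huv i) h0)) fun i j hij => ?_
    refine mul_eq_zero_of_idempotent_of_anticommute (hP i) ?_
    rw [← hΦ.map_mul_add_mul, map_add, hkill i j hij, hkill j i hij.symm, add_zero]
  have hle : Cardinal.mk (ℕ → Bool) ≤ Cardinal.aleph0 := Cardinal.mk_le_aleph0_iff.mpr hcount
  have hc : Cardinal.mk (ℕ → Bool) = Cardinal.continuum := by
    rw [← Cardinal.power_def, Cardinal.mk_bool, Cardinal.mk_nat, Cardinal.two_power_aleph0]
  exact absurd Cardinal.aleph0_lt_continuum (not_lt.mpr (hc ▸ hle))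

/-! ### Characters from the Stone–Čech remainder -/

section StoneCech

theorem exists_continuous_extension_stoneCech (f : lp (fun _ : ℕ => ℂ) ∞) :
    ∃ g : C(StoneCech ℕ, ℂ), ∀ n, g (stoneCechUnit n) = f n := by
  have : CompactSpace (Metric.closedBall (0 : ℂ) ‖f‖) :=
    isCompact_iff_compactSpace.mp (isCompact_closedBall _ _)
  let f' : ℕ → Metric.closedBall (0 : ℂ) ‖f‖ := fun n =>
    ⟨f n, by simpa using lp.norm_apply_le_norm ENNReal.top_ne_zero f n⟩
  have hf' : Continuous f' := continuous_of_discreteTopology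
  refine ⟨⟨fun x => (stoneCechExtend hf' x).val,
    continuous_subtype_val.comp (continuous_stoneCechExtend hf')⟩, fun n => ?_⟩
  simp [stoneCechExtend_stoneCechUnit, f']

theorem continuousMap_stoneCech_ext {α β : Type*} [TopologicalSpace α] [TopologicalSpace β]
    [T2Space β] {g h : C(StoneCech α, β)}
    (H : ∀ n, g (stoneCechUnit n) = h (stoneCechUnit n)) : g = h :=
  DFunLike.coe_injective
    (denseRange_stoneCechUnit.equalizer g.continuous h.continuous (funext H))

/-- The extension of `1 / (n + 1)` attains its minimum modulus by compactness; on `ℕ` the values are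
nonzero with infimum `0`, so no point of `ℕ` can be the minimiser. -/
theorem exists_notMem_range_stoneCechUnit :
    ∃ p : StoneCech ℕ, p ∉ Set.range (stoneCechUnit : ℕ → StoneCech ℕ) := by
  by_contra! hall
  let f : lp (fun _ : ℕ => ℂ) ∞ := ⟨fun n => 1 / ((n : ℂ) + 1), memℓp_infty_of_norm_le 1 fun n => by
    rw [show (n : ℂ) + 1 = ((n + 1 : ℕ) : ℂ) by push_cast; rfl, norm_div, norm_one,
      Complex.norm_natCast]
    exact (div_le_one (by positivity)).mpr (by simp)⟩
  obtain ⟨g, hg⟩ := exists_continuous_extension_stoneCech f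
  have : Nonempty (StoneCech ℕ) := ⟨stoneCechUnit 0⟩
  obtain ⟨x, -, hx⟩ := isCompact_univ.exists_isMinOn Set.univ_nonempty
    (f := fun x => ‖g x‖) (g.continuous.norm.continuousOn)
  have hmin : ∀ n, ‖g x‖ ≤ ‖f n‖ := fun n => by
    rw [← hg n]; exact hx (Set.mem_univ _)
  have hfn : ∀ n, ‖f n‖ = 1 / ((n : ℝ) + 1) := fun n => by
    change ‖1 / ((n : ℂ) + 1)‖ = _
    rw [show (n : ℂ) + 1 = ((n + 1 : ℕ) : ℂ) by push_cast; rfl, norm_div, norm_one,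
      Complex.norm_natCast]
    push_cast; rfl
  obtain ⟨m, rfl⟩ := hall x
  obtain ⟨n, hn⟩ := exists_nat_one_div_lt (show 0 < ‖f m‖ by rw [hfn]; positivity)
  have := hmin n
  rw [hg, hfn n] at this
  linarith

/-- If `g p ≠ 0`, removing finitely many points from `{x | g x ≠ 0}` leaves an open set around `p`
that misses the dense image of `ℕ`. -/
theorem eq_zero_of_isCofiniteSeq_of_notMem_range {p : StoneCech ℕ}
    (hp : p ∉ Set.range (stoneCechUnit : ℕ → StoneCech ℕ)) {g : C(StoneCech ℕ, ℂ)}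
    (hg : IsCofiniteSeq fun n => g (stoneCechUnit n)) : g p = 0 := by
  by_contra hgp
  have hF : ((stoneCechUnit : ℕ → StoneCech ℕ) '' {n | g (stoneCechUnit n) ≠ 0}).Finite :=
    Set.Finite.image _ hg
  have hU : IsOpen ({x | g x ≠ 0} \
      ((stoneCechUnit : ℕ → StoneCech ℕ) '' {n | g (stoneCechUnit n) ≠ 0})) :=
    (isOpen_ne_fun g.continuous continuous_const).sdiff hF.isClosed
  obtain ⟨n, hn, hn'⟩ := denseRange_stoneCechUnit.exists_mem_open hU
    ⟨p, hgp, fun ⟨n, _, hn⟩ => hp ⟨n, hn⟩⟩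
  exact hn' ⟨n, hn, rfl⟩

theorem exists_character_of_stoneCech (p : StoneCech ℕ) :
    ∃ χ : lp (fun _ : ℕ => ℂ) ∞ →ₐ[ℂ] ℂ,
      ∀ (f : lp (fun _ : ℕ => ℂ) ∞) (g : C(StoneCech ℕ, ℂ)),
        (∀ n, g (stoneCechUnit n) = f n) → χ f = g p := by
  choose E hE using exists_continuous_extension_stoneCech
  -- Uniqueness of extensions makes `E` an algebra homomorphism.
  have hE' : ∀ f g, (∀ n, g (stoneCechUnit n) = f n) → E f = g := fun f g h =>
    continuousMap_stoneCech_ext fun n => by rw [hE, h]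
  refine ⟨
    { toFun := fun f => E f p
      map_one' := ?_
      map_mul' := fun f g => ?_
      map_zero' := ?_
      map_add' := fun f g => ?_
      commutes' := fun c => ?_ }, fun f g h => ?_⟩
  · rw [hE' 1 1 fun n => rfl]; rfl
  · rw [hE' (f * g) (E f * E g) fun n => by simp [hE]]; rfl
  · rw [hE' 0 0 fun n => rfl]; rfl
  · rw [hE' (f + g) (E f + E g) fun n => by simp [hE]]; rfl
  · rw [hE' (algebraMap ℂ _ c) (algebraMap ℂ _ c) fun n => rfl]; rfl
  · exact congrArg (fun k : C(StoneCech ℕ, ℂ) => k p) (hE' f g h)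

end StoneCech

theorem theorem1 {H : Type*} [NormedAddCommGroup H] [InnerProductSpace ℂ H] [CompleteSpace H]
    [TopologicalSpace.SeparableSpace H] (hH : ¬ FiniteDimensional ℂ H) :
    -- no nonzero Jordan homomorphism vanishes on all cofinite sequences
    (¬ ∃ Φ : lp (fun _ : ℕ => H →L[ℂ] H) ∞ →ₗ[ℂ] (H →L[ℂ] H),
      IsJordanHom Φ ∧ Φ ≠ 0 ∧
        ∀ A : lp (fun _ : ℕ => H →L[ℂ] H) ∞, IsCofiniteSeq (fun n => A n) → Φ A = 0) ∧
    -- nor on all cofinite sequences with finite-rank coordinates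
    (¬ ∃ Φ : lp (fun _ : ℕ => H →L[ℂ] H) ∞ →ₗ[ℂ] (H →L[ℂ] H),
      IsJordanHom Φ ∧ Φ ≠ 0 ∧
        ∀ A : lp (fun _ : ℕ => H →L[ℂ] H) ∞, IsCofiniteSeq (fun n => A n) →
          (∀ n, IsFiniteRankOp (A n)) → Φ A = 0) ∧
    -- in contrast, points of the Stone-Cech remainder exist, and evaluation of the unique
    -- continuous extension at any of them is a character that kills the cofinite sequences
    (∃ p : StoneCech ℕ, p ∉ Set.range (stoneCechUnit : ℕ → StoneCech ℕ)) ∧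
    (∀ f : lp (fun _ : ℕ => ℂ) ∞, ∃! g : C(StoneCech ℕ, ℂ), ∀ n, g (stoneCechUnit n) = f n) ∧
    (∀ p : StoneCech ℕ, p ∉ Set.range (stoneCechUnit : ℕ → StoneCech ℕ) →
      ∃ χ : lp (fun _ : ℕ => ℂ) ∞ →ₐ[ℂ] ℂ,
        (∀ (f : lp (fun _ : ℕ => ℂ) ∞) (g : C(StoneCech ℕ, ℂ)),
          (∀ n, g (stoneCechUnit n) = f n) → χ f = g p) ∧
        ∀ f : lp (fun _ : ℕ => ℂ) ∞, IsCofiniteSeq (fun n => f n) → χ f = 0) := by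
  refine ⟨?_, ?_, exists_notMem_range_stoneCechUnit, fun f => ?_, fun p hp => ?_⟩
  · rintro ⟨Φ, hΦ, hne, hv⟩
    exact hne (hΦ.eq_zero_of_finiteRank_cofinite hH fun A hA _ => hv A hA)
  · rintro ⟨Φ, hΦ, hne, hv⟩
    exact hne (hΦ.eq_zero_of_finiteRank_cofinite hH hv)
  · obtain ⟨g, hg⟩ := exists_continuous_extension_stoneCech f
    exact ⟨g, hg, fun g' hg' => continuousMap_stoneCech_ext fun n => by rw [hg, hg']⟩
  · obtain ⟨χ, hχ⟩ := exists_character_of_stoneCech p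
    refine ⟨χ, hχ, fun f hf => ?_⟩
    obtain ⟨g, hg⟩ := exists_continuous_extension_stoneCech f
    rw [hχ f g hg]
    refine eq_zero_of_isCofiniteSeq_of_notMem_range hp ?_
    simpa only [hg] using hf
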